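/- Let $p$ be an odd prime, let $n \ge 1$, and let $G = \mathrm{Hol}(C_{p^n}) = C_{p^n} \rtimes \mathrm{Aut}(C_{p^n})$ be the holomorph of the cyclic group $C_{p^n}$ of order $p^n$, i.e. the semidirect product with respect to the natural action of $\mathrm{Aut}(C_{p^n})$ on $C_{p^n}$. For $m \ge 1$ let $\zeta_m$ denote a primitive $m$-th root of unity, and let $\varphi$ be Euler's totient function. Then the Wedderburn decomposition of the rational group algebra of $G$ is given by an isomorphism of $\mathbb{Q}$-algebras $$\mathbb{Q}[G] \;\cong\; \bigoplus_{d \mid \varphi(p^n)} \mathbb{Q}(\zeta_d) \;\oplus\; \bigoplus_{k=1}^{n} \bigoplus_{l=0}^{n-k} M_{\varphi(p^k)}\bigl(\mathbb{Q}(\zeta_{p^l})\bigr),$$ where $d$ runs over the positive divisors of $\varphi(p^n)$ and $M_r(K)$ denotes the algebra of $r \times r$ matrices over $K$. -/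

import Mathlib

/-- The holomorph of a group `G`: the semidirect product of `G` with its automorphism group,
with respect to the natural action of `MulAut G` on `G`. -/
abbrev Hol (G : Type*) [Group G] : Type _ :=
  G ⋊[MonoidHom.id (MulAut G)] MulAut G

open Polynomial

/-! Let `c` generate `C` and `α` its automorphism group, which is cyclic since `p` is odd, with `α c
= c ^ a`. Sending `c` to `1` and `α` to `ζ_d` gives the fields. Otherwise `c` goes to a primitive `p
^ k`-th root of unity, on which `α` acts as a generator `σ` of the Galois group, and `α ^ φ(p ^ k)`
goes to a central root of unity `ω` of order `p ^ l`. The image is the cyclic algebra over `K =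
ℚ(ω)` built from `K ⊗ ℚ(ζ_{p ^ k})`, `σ` and `ω`. It is a matrix algebra because `ω` is a norm
(`exists_prod_primitiveRoots_eq_root_of_unity`), and `exists_matrix_generators` makes this explicit.

Polynomials in `c` and in powers of `α` separate the components, so the map to their product is
surjective. Both sides have dimension `p ^ n * φ(p ^ n)`, so it is an isomorphism. -/

/-! ### Roots of unity as cyclotomic norms -/

/-- A polynomial over `K` that vanishes at every primitive `m`-th root of unity of an algebraically
closed extension is divisible by the `m`-th cyclotomic polynomial. -/
theorem cyclotomic_dvd_of_forall_isPrimitiveRoot {K : Type*} (E : Type*) [Field K] [Field E]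
    [Algebra K E] [IsAlgClosed E] [CharZero E] {m : ℕ} (hm : 0 < m) (P : K[X])
    (h : ∀ ξ : E, IsPrimitiveRoot ξ m → aeval ξ P = 0) : cyclotomic m K ∣ P := by
  have : NeZero (m : E) := ⟨by exact_mod_cast hm.ne'⟩
  obtain ⟨ξ, hξ⟩ := HasEnoughRootsOfUnity.exists_primitiveRoot E m
  rw [← Polynomial.map_dvd_map' (algebraMap K E), map_cyclotomic,
    cyclotomic_eq_prod_X_sub_primitiveRoots hξ]
  refine Finset.prod_dvd_of_coprime (fun x _ y _ hxy => ?_) fun x hx => ?_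
  · exact isCoprime_X_sub_C_of_isUnit_sub (sub_ne_zero.2 hxy).isUnit
  · rw [dvd_iff_isRoot, IsRoot, eval_map_algebraMap]
    exact h x ((mem_primitiveRoots hm).1 hx)

/-- If `a` has order `φ(m)` modulo `m`, then the powers `ξ ^ a ^ i` enumerate the primitive `m`-th
roots of unity. -/
theorem prod_range_totient_pow_pow {E M : Type*} [Field E] [CommMonoid M] {m a : ℕ} (hm : 0 < m)
    (ha : orderOf (a : ZMod m) = m.totient) {ξ : E} (hξ : IsPrimitiveRoot ξ m) (f : E → M) :
    ∏ i ∈ Finset.range m.totient, f (ξ ^ a ^ i) = ∏ x ∈ primitiveRoots m E, f x := by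
  classical
  have : NeZero m := ⟨hm.ne'⟩
  have hcop : a.Coprime m := by
    rw [← ZMod.isUnit_iff_coprime]
    exact (orderOf_pos_iff.1 (ha ▸ Nat.totient_pos.2 hm)).isUnit
  have hinj : Set.InjOn (fun i => ξ ^ a ^ i) (Finset.range m.totient : Finset ℕ) := by
    intro i hi j hj hij
    simp only [Finset.coe_range, Set.mem_Iio] at hi hj
    have h1 : a ^ i ≡ a ^ j [MOD m] := by
      have h2 : (hξ.isUnit hm.ne').unit ^ a ^ i = (hξ.isUnit hm.ne').unit ^ a ^ j :=
        Units.ext (by simpa using hij)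
      rw [pow_eq_pow_iff_modEq, ← orderOf_units, IsUnit.unit_spec, ← hξ.eq_orderOf] at h2
      exact h2
    rw [← ZMod.natCast_eq_natCast_iff] at h1
    push_cast at h1
    refine pow_injOn_Iio_orderOf ?_ ?_ h1 <;> simpa [ha]
  have himg : (Finset.range m.totient).image (fun i => ξ ^ a ^ i) = primitiveRoots m E := by
    refine Finset.eq_of_subset_of_card_le ?_ ?_
    · intro x hx
      obtain ⟨i, -, rfl⟩ := Finset.mem_image.1 hx
      exact (mem_primitiveRoots hm).2 (hξ.pow_of_coprime _ (hcop.pow_left i))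
    · rw [Finset.card_image_of_injOn hinj, hξ.card_primitiveRoots, Finset.card_range]
  rw [← himg, Finset.prod_image hinj]

/-- If `D` divides the `m`-th cyclotomic polynomial, there is a polynomial `q` that agrees with `y`
at the roots of `D` and is `1` at the remaining primitive `m`-th roots of unity. -/
theorem exists_prod_primitiveRoots_eq {K : Type*} [Field K] [CharZero K] {m : ℕ} (hm : 0 < m)
    (D y : K[X]) (hD : D ∣ cyclotomic m K) :
    ∃ q : K[X], ∀ (E : Type _) [Field E] [Algebra K E] [IsAlgClosed E],
      ∏ x ∈ primitiveRoots m E, aeval x q = ((D.aroots E).map fun x => aeval x y).prod := by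
  have : NeZero (m : K) := ⟨by exact_mod_cast hm.ne'⟩
  obtain ⟨R, hR⟩ := hD
  have hcop : IsCoprime D R := by
    have hs : (cyclotomic m K).Separable := separable_cyclotomic m K
    rw [hR] at hs
    exact hs.isCoprime
  obtain ⟨u, v, huv⟩ := hcop
  -- Chinese remainder: this is `y` modulo `D` and `1` modulo `R`.
  refine ⟨u * D + v * R * y, fun E _ _ _ => ?_⟩
  have : CharZero E := charZero_of_injective_algebraMap (algebraMap K E).injective
  have : NeZero (m : E) := ⟨by exact_mod_cast hm.ne'⟩
  have hne : D * R ≠ 0 := hR ▸ cyclotomic_ne_zero m K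
  have hroots : (primitiveRoots m E).val = D.aroots E + R.aroots E := by
    rw [← aroots_mul hne, ← hR, aroots, map_cyclotomic, cyclotomic.roots_eq_primitiveRoots_val]
  have hval (x : E) : aeval x u * aeval x D + aeval x v * aeval x R = 1 := by
    simpa using congrArg (aeval x) huv
  rw [Finset.prod, hroots, Multiset.map_add, Multiset.prod_add]
  have h1 : ((R.aroots E).map fun x => aeval x (u * D + v * R * y)).prod = 1 := by
    refine Multiset.prod_eq_one fun z hz => ?_
    obtain ⟨x, hx, rfl⟩ := Multiset.mem_map.1 hz
    have h0 := (mem_aroots.1 hx).2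
    have := hval x
    simp only [h0, mul_zero, add_zero] at this
    simp [h0, this]
  rw [h1, mul_one]
  congr 1
  refine Multiset.map_congr rfl fun x hx => ?_
  have h0 := (mem_aroots.1 hx).2
  have := hval x
  simp only [h0, mul_zero, zero_add] at this
  simp [h0, this]

/-- For an odd prime `p`, every `p ^ l`-th root of unity of `K` is a norm from
`K[X] ⧸ (cyclotomic (p ^ k) K)`. -/
theorem exists_prod_primitiveRoots_eq_root_of_unity {K : Type*} [Field K] [CharZero K] {p : ℕ}
    (hp : p.Prime) (hp2 : p ≠ 2) (k l : ℕ) {ω : K} (hω : IsPrimitiveRoot ω (p ^ l)) :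
    ∃ q : K[X], ∀ (E : Type _) [Field E] [Algebra K E] [IsAlgClosed E],
      ∏ x ∈ primitiveRoots (p ^ k) E, aeval x q = algebraMap K E ω := by
  have hpk : 0 < p ^ k := pow_pos hp.pos k
  -- The case `l = 0` is separate: `X ^ p ^ k - 1` does not divide the cyclotomic polynomial when `k
  -- ≥ 1`.
  rcases Nat.eq_zero_or_pos l with rfl | hl
  · rw [pow_zero, IsPrimitiveRoot.one_right_iff] at hω
    exact ⟨1, fun E _ _ _ => by simp [hω]⟩
  rcases le_total k l with hkl | hkl
  · have hη : IsPrimitiveRoot (ω ^ p ^ (l - k)) (p ^ k) :=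
      hω.pow (pow_pos hp.pos l) (by rw [← pow_add]; congr 1; omega)
    -- `K` contains a primitive `p ^ k`-th root of unity: take the value `ω` there and `1` at all
    -- the others.
    obtain ⟨q, hq⟩ := exists_prod_primitiveRoots_eq hpk (X - C (ω ^ p ^ (l - k))) (C ω)
      (dvd_iff_isRoot.2 (hη.isRoot_cyclotomic hpk))
    exact ⟨q, fun E _ _ _ => by rw [hq E, aroots_X_sub_C]; simp⟩
  · have hexp : ∀ j, expand K (p ^ j) (cyclotomic (p ^ l) K) = cyclotomic (p ^ (l + j)) K := by
      intro j
      induction j with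
      | zero => simp
      | succ j ih =>
        rw [pow_succ', expand_mul, ih, cyclotomic_expand_eq_cyclotomic hp
          (dvd_pow_self p (by omega)), ← add_assoc, pow_succ]
    have hdvd : (X ^ p ^ (k - l) - C ω : K[X]) ∣ cyclotomic (p ^ k) K := by
      have h1 : (X - C ω) ∣ cyclotomic (p ^ l) K :=
        dvd_iff_isRoot.2 (hω.isRoot_cyclotomic (pow_pos hp.pos l))
      have h2 := _root_.map_dvd (expand K (p ^ (k - l))) h1
      rw [hexp, Nat.add_sub_cancel' hkl] at h2
      simpa using h2
    -- Now `q` is the root itself on the factor `X ^ p ^ (k - l) - ω`, whose roots multiply to `ω`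
    -- because its degree is odd.
    obtain ⟨q, hq⟩ := exists_prod_primitiveRoots_eq hpk _ X hdvd
    refine ⟨q, fun E _ _ _ => ?_⟩
    have hpos : 0 < p ^ (k - l) := pow_pos hp.pos _
    rw [hq E]
    simp only [aeval_X, Multiset.map_id']
    have hmon : (X ^ p ^ (k - l) - C (algebraMap K E ω)).Monic := monic_X_pow_sub_C _ hpos.ne'
    have h3 := (IsAlgClosed.splits
      (X ^ p ^ (k - l) - C (algebraMap K E ω))).coeff_zero_eq_prod_roots_of_monic hmon
    rw [aroots]
    simp only [Polynomial.map_sub, Polynomial.map_pow, map_X, map_C]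
    rw [natDegree_X_pow_sub_C, ((hp.odd_of_ne_two hp2).pow).neg_one_pow] at h3
    simp only [coeff_sub, coeff_X_pow, coeff_C_zero, hpos.ne, if_false, zero_sub] at h3
    linear_combination h3

/-- The norm equation solved by `exists_prod_primitiveRoots_eq_root_of_unity`, written with a
generator `a` of `(ZMod (p ^ k))ˣ`. -/
theorem exists_cyclotomic_dvd_prod_expand_sub {K : Type*} [Field K] [CharZero K] {p : ℕ}
    (hp : p.Prime) (hp2 : p ≠ 2) {k l a : ℕ} {ω : K} (hω : IsPrimitiveRoot ω (p ^ l))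
    (ha : orderOf (a : ZMod (p ^ k)) = (p ^ k).totient) :
    ∃ q : K[X], cyclotomic (p ^ k) K ∣
      ∏ i ∈ Finset.range (p ^ k).totient, expand K (a ^ i) q - C ω := by
  obtain ⟨q, hq⟩ := exists_prod_primitiveRoots_eq_root_of_unity hp hp2 k l hω
  have hpk : 0 < p ^ k := pow_pos hp.pos k
  have : CharZero (AlgebraicClosure K) :=
    charZero_of_injective_algebraMap (algebraMap K (AlgebraicClosure K)).injective
  refine ⟨q, cyclotomic_dvd_of_forall_isPrimitiveRoot (AlgebraicClosure K) hpk _ fun ξ hξ => ?_⟩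
  have h := prod_range_totient_pow_pow hpk ha hξ fun x => aeval x q
  rw [hq] at h
  simp [map_prod, expand_aeval, h]

/-! ### Separating polynomials and cyclic algebras -/

/-- Polynomials that separate a cyclotomic polynomial from finitely many others. -/
theorem exists_cyclotomic_idempotent (s : Finset ℕ) (d : ℕ) :
    ∃ e : ℚ[X], cyclotomic d ℚ ∣ e - 1 ∧ ∀ d' ∈ s, d' ≠ d → cyclotomic d' ℚ ∣ e := by
  have h : IsCoprime (cyclotomic d ℚ) (∏ d' ∈ s.erase d, cyclotomic d' ℚ) :=
    IsCoprime.prod_right fun d' hd' => cyclotomic.isCoprime_rat (Finset.ne_of_mem_erase hd').symm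
  obtain ⟨u, v, huv⟩ := h
  refine ⟨v * ∏ d' ∈ s.erase d, cyclotomic d' ℚ, ⟨-u, by linear_combination huv⟩, ?_⟩
  intro d' hd' hne
  exact (Finset.dvd_prod_of_mem _ (Finset.mem_erase.2 ⟨hne, hd'⟩)).mul_left _

theorem aeval_eq_of_aeval_eq_zero_of_dvd_sub {R A : Type*} [CommRing R] [Ring A] [Algebra R A]
    {f g h : R[X]} {x : A} (hx : aeval x f = 0) (hf : f ∣ g - h) : aeval x g = aeval x h := by
  obtain ⟨u, hu⟩ := hf
  rw [← sub_eq_zero, ← map_sub, hu, map_mul, hx, zero_mul]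

theorem SemiconjBy.mul_aeval {K M : Type*} [CommRing K] [Ring M] [Algebra K M] {S z : M} {a : ℕ}
    (h : SemiconjBy S z (z ^ a)) (P : K[X]) :
    S * aeval z P = aeval z (expand K a P) * S := by
  rw [expand_aeval]
  induction P using Polynomial.induction_on' with
  | add P Q hP hQ => simp only [map_add, mul_add, add_mul, hP, hQ]
  | monomial n c =>
    rw [aeval_monomial, aeval_monomial, ← mul_assoc, ← Algebra.commutes, mul_assoc,
      (h.pow_right n).eq, mul_assoc]

/-- Each `S` moved to the right replaces `z` by `z ^ a` in the factors it passes. When `t` is the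
order of `a`, the product of conjugates becomes a norm. -/
theorem SemiconjBy.aeval_mul_pow {K M : Type*} [CommRing K] [Ring M] [Algebra K M] {S z : M}
    {a : ℕ} (h : SemiconjBy S z (z ^ a)) (q : K[X]) (t : ℕ) :
    (aeval z q * S) ^ t = aeval z (∏ i ∈ Finset.range t, expand K (a ^ i) q) * S ^ t := by
  induction t with
  | zero => simp
  | succ t ih =>
    rw [pow_succ', ih, mul_assoc, ← mul_assoc S, h.mul_aeval, Finset.prod_range_succ', map_mul,
      map_prod, mul_assoc, ← pow_succ', ← mul_assoc, ← map_mul, ← map_mul, mul_comm q]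
    simp only [expand_expand, pow_succ', pow_zero, expand_one]

/-- The endomorphism algebra of a Galois extension with cyclic group is generated by
multiplications and a generator of the group. -/
theorem Subalgebra.eq_top_of_lmul_mem {F L : Type*} [Field F] [Field L] [Algebra F L]
    [FiniteDimensional F L] (σ : L ≃ₐ[F] L) (hσ : orderOf σ = Module.finrank F L)
    (R : Subalgebra F (Module.End F L)) (hL : ∀ y, Algebra.lmul F L y ∈ R)
    (hR : σ.toLinearMap ∈ R) : R = ⊤ := by
  have hpow (i : ℕ) : (σ ^ i).toLinearMap ∈ R := by
    have : (σ ^ i).toLinearMap = (σ.toLinearMap : Module.End F L) ^ i := by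
      induction i with
      | zero => rfl
      | succ i ih => rw [pow_succ, pow_succ, ← ih]; rfl
    rw [this]
    exact pow_mem hR i
  let v : Fin (Module.finrank F L) → (L →ₐ[F] L) := fun i => (σ ^ (i : ℕ) : L ≃ₐ[F] L)
  have hv : Function.Injective v := by
    intro i j hij
    have h1 : σ ^ (i : ℕ) = σ ^ (j : ℕ) := by
      ext x
      exact DFunLike.congr_fun hij x
    exact Fin.ext (pow_injOn_Iio_orderOf (by simp [hσ]) (by simp [hσ]) h1)
  -- Dedekind independence of characters, over `L`: the powers of `σ` are as many as the
  -- `L`-dimension of the endomorphism space.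
  have hli := (linearIndependent_toLinearMap F L L).comp v hv
  have hspan := hli.span_eq_top_of_card_eq_finrank' (by
    rw [Fintype.card_fin, Module.finrank_linearMap_self])
  rw [eq_top_iff]
  rintro f -
  have hf : f ∈ Submodule.span L (Set.range (AlgHom.toLinearMap ∘ v)) := hspan ▸ Submodule.mem_top
  obtain ⟨c, rfl⟩ := (Submodule.mem_span_range_iff_exists_fun L).1 hf
  refine sum_mem fun i _ => ?_
  exact mul_mem (hL (c i)) (hpow i)

theorem IsPrimitiveRoot.aeval_cyclotomic_eq_zero {L : Type*} [Field L] [CharZero L] [Algebra ℚ L]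
    {m : ℕ} (hm : 0 < m) {ζ : L} (h : IsPrimitiveRoot ζ m) : aeval ζ (cyclotomic m ℚ) = 0 := by
  rw [← eval_map_algebraMap, map_cyclotomic]
  exact h.isRoot_cyclotomic hm

/-- `CyclotomicField m ℚ` is a cyclotomic extension for the `ℚ`-algebra structure that it carries as
a division ring of characteristic zero. -/
instance CyclotomicField.isCyclotomicExtension_rat (m : ℕ) :
    IsCyclotomicExtension {m} ℚ (CyclotomicField m ℚ) := by
  have h : @IsCyclotomicExtension {m} ℚ (CyclotomicField m ℚ) _ _ (CyclotomicField.algebra m ℚ) :=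
    inferInstance
  convert h
  exact Subsingleton.elim _ _

theorem Subalgebra.aeval_mem {F A : Type*} [CommRing F] [Ring A] [Algebra F A]
    (R : Subalgebra F A) {x : A} (hx : x ∈ R) (P : F[X]) : aeval x P ∈ R :=
  Algebra.adjoin_le (Set.singleton_subset_iff.2 hx) (aeval_mem_adjoin_singleton F x)

theorem CyclotomicField.exists_aeval_eq {m : ℕ} (hm : 0 < m) {ζ : CyclotomicField m ℚ}
    (h : IsPrimitiveRoot ζ m) (y : CyclotomicField m ℚ) : ∃ P : ℚ[X], aeval ζ P = y := by
  have : NeZero m := ⟨hm.ne'⟩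
  have hy : y ∈ Algebra.adjoin ℚ {ζ} := by
    rw [IsCyclotomicExtension.adjoin_primitive_root_eq_top h]
    trivial
  rw [Algebra.adjoin_singleton_eq_range_aeval] at hy
  exact hy

/-- The twisted monomial data defining the simple component `M_{φ(p ^ k)}(ℚ(ζ_{p ^ l}))`: matrices
`z` and `T` generating the full matrix algebra, with `z` of order `p ^ k`, `T` acting on `z` as
`z ↦ z ^ a`, and `T ^ φ(p ^ k)` a scalar of order `p ^ l`. -/
theorem exists_matrix_generators {p : ℕ} (hp : p.Prime) (hp2 : p ≠ 2) {k a : ℕ} (l : ℕ)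
    (ha : orderOf (a : ZMod (p ^ k)) = (p ^ k).totient) :
    ∃ (ω : CyclotomicField (p ^ l) ℚ) (z T : Matrix (Fin (p ^ k).totient) (Fin (p ^ k).totient)
        (CyclotomicField (p ^ l) ℚ)),
      IsPrimitiveRoot ω (p ^ l) ∧ z ^ p ^ k = 1 ∧ aeval z (cyclotomic (p ^ k) ℚ) = 0 ∧
      SemiconjBy T z (z ^ a) ∧ T ^ (p ^ k).totient = algebraMap _ _ ω ∧
      ∀ R : Subalgebra ℚ (Matrix (Fin (p ^ k).totient) (Fin (p ^ k).totient)
        (CyclotomicField (p ^ l) ℚ)), z ∈ R → T ∈ R → R = ⊤ := by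
  have hpk : 0 < p ^ k := pow_pos hp.pos k
  have hpl : 0 < p ^ l := pow_pos hp.pos l
  have : NeZero (p ^ k) := ⟨hpk.ne'⟩
  have : NeZero (p ^ l) := ⟨hpl.ne'⟩
  let L := CyclotomicField (p ^ k) ℚ
  let K := CyclotomicField (p ^ l) ℚ
  let r := (p ^ k).totient
  have hr : 0 < r := Nat.totient_pos.2 hpk
  have hirr : Irreducible (cyclotomic (p ^ k) ℚ) := cyclotomic.irreducible_rat hpk
  let ζ : L := IsCyclotomicExtension.zeta (p ^ k) ℚ L
  have hζ : IsPrimitiveRoot ζ (p ^ k) := IsCyclotomicExtension.zeta_spec (p ^ k) ℚ L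
  let ω : K := IsCyclotomicExtension.zeta (p ^ l) ℚ K
  have hω : IsPrimitiveRoot ω (p ^ l) := IsCyclotomicExtension.zeta_spec (p ^ l) ℚ K
  have hfin : Module.finrank ℚ L = r := IsCyclotomicExtension.finrank L hirr
  let b : Module.Basis (Fin r) ℚ L := Module.finBasisOfFinrankEq ℚ L hfin
  let M := Matrix (Fin r) (Fin r) K
  let j : Module.End ℚ L →ₐ[ℚ] M :=
    (Algebra.ofId ℚ K).mapMatrix.comp (LinearMap.toMatrixAlgEquiv b : _ →ₐ[ℚ] _)
  have hunit : IsUnit (a : ZMod (p ^ k)) :=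
    (orderOf_pos_iff.1 (ha ▸ Nat.totient_pos.2 hpk)).isUnit
  let σ : L ≃ₐ[ℚ] L := (IsCyclotomicExtension.autEquivPow L hirr).symm hunit.unit
  have hσζ : σ ζ = ζ ^ a := by
    have h := hζ.autToPow_spec ℚ σ
    have h2 : hζ.autToPow ℚ σ = hunit.unit :=
      (IsCyclotomicExtension.autEquivPow L hirr).apply_symm_apply hunit.unit
    rw [h2] at h
    rw [← h, IsUnit.unit_spec, ZMod.val_natCast]
    conv_rhs => rw [← Nat.mod_add_div a (p ^ k), pow_add, pow_mul, hζ.pow_eq_one, one_pow, mul_one]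
  have hσord : orderOf σ = r := by
    rw [show orderOf σ = orderOf hunit.unit from MulEquiv.orderOf_eq _ _, ← orderOf_units,
      IsUnit.unit_spec, ha]
  have hσr : (σ.toLinearMap : Module.End ℚ L) ^ r = 1 := by
    have h (i : ℕ) : (σ.toLinearMap : Module.End ℚ L) ^ i = (σ ^ i).toLinearMap := by
      induction i with
      | zero => rfl
      | succ i ih => rw [pow_succ, pow_succ, ih]; rfl
    rw [h, ← hσord, pow_orderOf_eq_one]
    rfl
  let S : M := j σ.toLinearMap
  let z : M := j (Algebra.lmul ℚ L ζ)
  have hSr : S ^ r = 1 := by rw [← map_pow, hσr, map_one]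
  have hz1 : z ^ p ^ k = 1 := by rw [← map_pow, ← map_pow, hζ.pow_eq_one, map_one, map_one]
  have hzQ (P : ℚ[X]) : aeval z P = j (Algebra.lmul ℚ L (aeval ζ P)) := by
    rw [← aeval_algHom_apply, ← aeval_algHom_apply]
  have hzΦ : aeval z (cyclotomic (p ^ k) ℚ) = 0 := by
    rw [hzQ, hζ.aeval_cyclotomic_eq_zero hpk, map_zero, map_zero]
  have hzΦK : aeval z (cyclotomic (p ^ k) K) = 0 := by
    rw [← hzΦ, ← map_cyclotomic (p ^ k) (algebraMap ℚ K), aeval_map_algebraMap]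
  have hSz : SemiconjBy S z (z ^ a) := by
    have h : σ.toLinearMap * Algebra.lmul ℚ L ζ = (Algebra.lmul ℚ L ζ) ^ a * σ.toLinearMap := by
      rw [← map_pow, ← hσζ]
      ext x
      simp
    change S * z = z ^ a * S
    rw [← map_pow, ← map_mul, ← map_mul, h]
  obtain ⟨q, hq⟩ := exists_cyclotomic_dvd_prod_expand_sub hp hp2 hω ha
  -- Since `S ^ r = 1`, twisting `S` by `q(z)` makes `T ^ r` the norm of `q(z)`, which is `ω`.
  let T : M := aeval z q * S
  have hprod : aeval z (∏ i ∈ Finset.range r, expand K (a ^ i) q) = algebraMap K M ω := by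
    rw [aeval_eq_of_aeval_eq_zero_of_dvd_sub hzΦK hq, aeval_C]
  have hTr : T ^ r = algebraMap K M ω := by
    rw [hSz.aeval_mul_pow, hSr, mul_one, hprod]
  have hTz : SemiconjBy T z (z ^ a) := by
    refine SemiconjBy.mul_left ?_ hSz
    change aeval z q * z ^ a = z ^ a * aeval z q
    have h : z ^ a = aeval z (X ^ a : K[X]) := by simp
    rw [h, ← map_mul, ← map_mul, mul_comm]
  refine ⟨ω, z, T, hω, hz1, hzΦ, hTz, hTr, fun R hzR hTR => ?_⟩
  have hK (y : K) : algebraMap K M y ∈ R := by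
    obtain ⟨P, rfl⟩ := CyclotomicField.exists_aeval_eq hpl hω y
    have h : algebraMap K M (aeval ω P) = aeval (algebraMap K M ω) P := by
      exact (aeval_algebraMap_apply M ω P).symm
    rw [h, ← hTr]
    exact Subalgebra.aeval_mem _ (pow_mem hTR r) P
  have hKz (P : K[X]) : aeval z P ∈ R := by
    rw [aeval_eq_sum_range]
    refine sum_mem fun i _ => ?_
    rw [Algebra.smul_def]
    exact mul_mem (hK _) (pow_mem hzR i)
  have hSR : S ∈ R := by
    obtain ⟨s, hs⟩ : ∃ s, r = s + 1 := ⟨r - 1, by omega⟩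
    -- The conjugates of `q(z)` multiply to `ω`, so those with index at least `1`, divided by `ω`,
    -- invert `q(z)`; this recovers `S` from `T`.
    have h1 : aeval z (C ω⁻¹ * ∏ i ∈ Finset.range s, expand K (a ^ (i + 1)) q) * aeval z q =
        (1 : M) := by
      rw [← map_mul, mul_assoc]
      have h2 := hprod
      have h3 : Finset.range r = Finset.range (s + 1) := by rw [hs]
      rw [h3, Finset.prod_range_succ', pow_zero, expand_one] at h2
      rw [map_mul, h2, aeval_C, ← map_mul, inv_mul_cancel₀ (hω.ne_zero hpl.ne'), map_one]
    have h3 : S = aeval z (C ω⁻¹ * ∏ i ∈ Finset.range s, expand K (a ^ (i + 1)) q) * T := by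
      rw [← mul_assoc, h1, one_mul]
    rw [h3]
    exact mul_mem (hKz _) hTR
  have htop : R.comap j = ⊤ := by
    refine Subalgebra.eq_top_of_lmul_mem σ (hσord.trans hfin.symm) _ (fun y => ?_) hSR
    obtain ⟨P, rfl⟩ := CyclotomicField.exists_aeval_eq hpk hζ y
    rw [Subalgebra.mem_comap, ← hzQ]
    exact Subalgebra.aeval_mem _ hzR P
  have hj (f) : j f ∈ R := by
    have : f ∈ R.comap j := htop ▸ Algebra.mem_top
    exact this
  rw [eq_top_iff]
  rintro A -
  rw [Matrix.matrix_eq_sum_single A]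
  refine sum_mem fun i _ => sum_mem fun i' _ => ?_
  -- Matrix units have rational entries, so they lie in the image of `j`; the scalars from `K` do
  -- the rest.
  have h4 : Matrix.single i i' (A i i') = algebraMap K M (A i i') *
      j ((LinearMap.toMatrixAlgEquiv b).symm (Matrix.single i i' 1)) := by
    have h5 : j ((LinearMap.toMatrixAlgEquiv b).symm (Matrix.single i i' 1)) =
        Matrix.single i i' 1 := by
      change (Algebra.ofId ℚ K).mapMatrix ((LinearMap.toMatrixAlgEquiv b)
        ((LinearMap.toMatrixAlgEquiv b).symm (Matrix.single i i' 1))) = _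
      rw [AlgEquiv.apply_symm_apply]
      simp
    rw [h5, ← Algebra.smul_def, Matrix.smul_single, smul_eq_mul, mul_one]
  rw [h4]
  exact mul_mem (hK _) (hj _)

/-! ### Generators and maps out of the group algebra -/

/-- Compatible generators of a cyclic group of odd prime power order and of its automorphism
group. -/
theorem exists_generators_of_card_eq_prime_pow {p n : ℕ} (hp : p.Prime) (hp2 : p ≠ 2)
    (C : Type*) [Group C] [IsCyclic C] (hC : Nat.card C = p ^ n) :
    ∃ (c : C) (α : MulAut C) (a : ℕ), (∀ x, x ∈ Subgroup.zpowers c) ∧ orderOf c = p ^ n ∧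
      (∀ x, x ∈ Subgroup.zpowers α) ∧ orderOf α = (p ^ n).totient ∧ α c = c ^ a ∧
      ∀ k ≤ n, orderOf (a : ZMod (p ^ k)) = (p ^ k).totient := by
  have hpn : 0 < p ^ n := pow_pos hp.pos n
  have : NeZero (p ^ n) := ⟨hpn.ne'⟩
  have : Finite C := Nat.finite_of_card_ne_zero (hC ▸ hpn.ne')
  have e : MulAut C ≃* (ZMod (p ^ n))ˣ := hC ▸ IsCyclic.mulAutMulEquiv C
  have : IsCyclic (ZMod (p ^ n))ˣ := ZMod.isCyclic_units_of_prime_pow p hp hp2 n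
  have : IsCyclic (MulAut C) := isCyclic_of_surjective e.symm e.symm.surjective
  have hcard : Nat.card (MulAut C) = (p ^ n).totient := by
    rw [Nat.card_congr e.toEquiv, Nat.card_eq_fintype_card, ZMod.card_units_eq_totient]
  obtain ⟨c, hc⟩ := IsCyclic.exists_generator (α := C)
  obtain ⟨α, hα⟩ := IsCyclic.exists_generator (α := MulAut C)
  obtain ⟨a, ha⟩ := mem_powers_iff_mem_zpowers.2 (hc (α c))
  have hoc : orderOf c = p ^ n := by rw [orderOf_eq_card_of_forall_mem_zpowers hc, hC]
  have hoα : orderOf α = (p ^ n).totient := by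
    rw [orderOf_eq_card_of_forall_mem_zpowers hα, hcard]
  have hpow (i : ℕ) : (α ^ i) c = c ^ a ^ i := by
    induction i with
    | zero => simp
    | succ i ih => rw [pow_succ, MulAut.mul_apply, ← ha, map_pow, ih, ← pow_mul, ← pow_succ]
  have hoa : orderOf (a : ZMod (p ^ n)) = orderOf α := by
    rw [orderOf_eq_orderOf_iff]
    intro i
    have h1 : α ^ i = 1 ↔ (α ^ i) c = c := by
      refine ⟨fun h => by simp [h], fun h => ?_⟩
      have h2 : (α ^ i : C ≃* C).toMonoidHom = MonoidHom.id C :=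
        (MonoidHom.eq_iff_eq_on_generator hc _ _).2 h
      ext x
      exact DFunLike.congr_fun h2 x
    rw [h1, hpow]
    nth_rw 2 [← pow_one c]
    rw [pow_eq_pow_iff_modEq, hoc, ← ZMod.natCast_eq_natCast_iff]
    push_cast
    rfl
  refine ⟨c, α, a, hc, hoc, hα, hoα, ha.symm, fun k hk => ?_⟩
  have hpk : 0 < p ^ k := pow_pos hp.pos k
  have : NeZero (p ^ k) := ⟨hpk.ne'⟩
  have hu : IsUnit (a : ZMod (p ^ n)) :=
    (orderOf_pos_iff.1 (hoa.trans hoα ▸ Nat.totient_pos.2 hpn)).isUnit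
  have hgen : ∀ x, x ∈ Subgroup.zpowers hu.unit := by
    have h3 : Nat.card (Subgroup.zpowers hu.unit) = Nat.card (ZMod (p ^ n))ˣ := by
      rw [Nat.card_zpowers, ← orderOf_units, IsUnit.unit_spec, hoa, hoα, Nat.card_eq_fintype_card,
        ZMod.card_units_eq_totient]
    intro x
    rw [Subgroup.eq_top_of_card_eq _ h3]
    trivial
  have hdvd : p ^ k ∣ p ^ n := pow_dvd_pow p hk
  -- Reduction of units modulo `p ^ k` is surjective, so it carries a generator to a generator.
  have hgen2 : ∀ y, y ∈ Subgroup.zpowers (ZMod.unitsMap hdvd hu.unit) := by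
    intro y
    obtain ⟨x, rfl⟩ := ZMod.unitsMap_surjective hdvd y
    obtain ⟨i, rfl⟩ := hgen x
    exact ⟨i, by simp⟩
  have hval : ((ZMod.unitsMap hdvd hu.unit : (ZMod (p ^ k))ˣ) : ZMod (p ^ k)) = a := by
    simp [ZMod.unitsMap_def]
  rw [← hval, orderOf_units, orderOf_eq_card_of_forall_mem_zpowers hgen2,
    Nat.card_eq_fintype_card, ZMod.card_units_eq_totient]

/-- An algebra homomorphism out of the group algebra of a holomorph, given by the images of a
generator of the group and a generator of its automorphism group. -/
theorem exists_algHom_monoidAlgebra_hol {C : Type*} [Group C] [Finite C] {c : C} {α : MulAut C}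
    {a : ℕ} (hc : ∀ x, x ∈ Subgroup.zpowers c) (hα : ∀ x, x ∈ Subgroup.zpowers α)
    (hac : α c = c ^ a) {M : Type*} [Ring M] [Algebra ℚ M] {z T : M} (hz : z ^ orderOf c = 1)
    (hT : T ^ orderOf α = 1) (hTz : SemiconjBy T z (z ^ a)) :
    ∃ f : MonoidAlgebra ℚ (Hol C) →ₐ[ℚ] M,
      f (MonoidAlgebra.of ℚ (Hol C) (SemidirectProduct.inl c)) = z ∧
      f (MonoidAlgebra.of ℚ (Hol C) (SemidirectProduct.inr α)) = T := by
  let zu : Mˣ := Units.ofPowEqOne z _ hz (orderOf_pos c).ne'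
  let Tu : Mˣ := Units.ofPowEqOne T _ hT (orderOf_pos α).ne'
  have hzu : (zu : M) = z := rfl
  have hTu : (Tu : M) = T := rfl
  have hzo : orderOf zu ∣ orderOf c := orderOf_dvd_of_pow_eq_one (Units.ext (by simp [hzu, hz]))
  have hTo : orderOf Tu ∣ orderOf α := orderOf_dvd_of_pow_eq_one (Units.ext (by simp [hTu, hT]))
  let f₁ : C →* Mˣ := monoidHomOfForallMemZpowers hc hzo
  let f₂ : MulAut C →* Mˣ := monoidHomOfForallMemZpowers hα hTo
  have hf₁ : f₁ c = zu := monoidHomOfForallMemZpowers_apply_gen hc hzo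
  have hf₂ : f₂ α = Tu := monoidHomOfForallMemZpowers_apply_gen hα hTo
  have hgen : f₁.comp (α : C ≃* C).toMonoidHom = (MulAut.conj Tu).toMonoidHom.comp f₁ := by
    rw [MonoidHom.eq_iff_eq_on_generator hc]
    simp only [MonoidHom.comp_apply, MulEquiv.toMonoidHom_eq_coe, MonoidHom.coe_coe, hac, map_pow,
      hf₁, MulAut.conj_apply]
    rw [eq_mul_inv_iff_mul_eq]
    exact Units.ext hTz.eq.symm
  have hpow (i : ℕ) (x : C) : f₁ ((α ^ i) x) = Tu ^ i * f₁ x * (Tu ^ i)⁻¹ := by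
    induction i generalizing x with
    | zero => simp
    | succ i ih =>
      have h1 : f₁ (α x) = Tu * f₁ x * Tu⁻¹ := DFunLike.congr_fun hgen x
      rw [pow_succ, MulAut.mul_apply, ih, h1]
      group
  have hcompat (g : MulAut C) : f₁.comp (MonoidHom.id (MulAut C) g).toMonoidHom =
      (MulAut.conj (f₂ g)).toMonoidHom.comp f₁ := by
    obtain ⟨i, rfl⟩ := mem_powers_iff_mem_zpowers.2 (hα g)
    refine MonoidHom.ext fun x => ?_
    change f₁ ((α ^ i) x) = f₂ (α ^ i) * f₁ x * (f₂ (α ^ i))⁻¹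
    rw [hpow, map_pow, hf₂]
  let F : Hol C →* Mˣ := SemidirectProduct.lift f₁ f₂ hcompat
  refine ⟨MonoidAlgebra.lift ℚ M (Hol C) ((Units.coeHom M).comp F), ?_, ?_⟩
  · rw [MonoidAlgebra.lift_of]
    simp [F, hf₁, hzu]
  · rw [MonoidAlgebra.lift_of]
    simp [F, hf₂, hTu]

/-! ### Joint surjectivity and the dimension count -/

/-- Chinese remainder: the sum of `e i * x i` glues preimages `x i` of the coordinates. The `e i`
need not be central or idempotent in `A`. -/
theorem pi_surjective_of_separating {ι k A : Type*} [Finite ι] [CommRing k] [Ring A] [Algebra k A]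
    {M : ι → Type*} [∀ i, Ring (M i)] [∀ i, Algebra k (M i)] (f : ∀ i, A →ₐ[k] M i)
    (hf : ∀ i, Function.Surjective (f i))
    (he : ∀ i, ∃ e, f i e = 1 ∧ ∀ j ≠ i, f j e = 0) :
    Function.Surjective fun a i => f i a := by
  classical
  have := Fintype.ofFinite ι
  intro y
  choose e he1 he0 using he
  choose x hx using fun i => hf i (y i)
  refine ⟨∑ i, e i * x i, funext fun j => ?_⟩
  dsimp only
  rw [map_sum, Finset.sum_eq_single j]
  · rw [map_mul, he1, hx, one_mul]
  · intro i _ hij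
    rw [map_mul, he0 i j hij.symm, zero_mul]
  · simp

theorem prod_surjective_of_separating {k A M N : Type*} [CommRing k] [Ring A] [Ring M] [Ring N]
    [Algebra k A] [Algebra k M] [Algebra k N] (f : A →ₐ[k] M) (g : A →ₐ[k] N)
    (hf : Function.Surjective f) (hg : Function.Surjective g)
    (he : ∃ e, f e = 1 ∧ g e = 0) : Function.Surjective fun a => (f a, g a) := by
  rintro ⟨y, z⟩
  obtain ⟨e, he1, he0⟩ := he
  obtain ⟨a, rfl⟩ := hf y
  obtain ⟨b, rfl⟩ := hg z
  exact ⟨e * a + (1 - e) * b, by simp [he1, he0]⟩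

/-- The inner totients sum to `p ^ (n - k)`, and `φ(p ^ k) * p ^ (n - k) = φ(p ^ n)`. The isolated
`φ(p ^ n)` is the missing `k = 0` term of the outer sum. -/
theorem sum_totient_mul_totient_prime_pow {p : ℕ} (hp : p.Prime) (n : ℕ) :
    (p ^ n).totient + ∑ k ∈ Finset.Icc 1 n, ∑ l ∈ Finset.Icc 0 (n - k),
      (p ^ k).totient * (p ^ k).totient * (p ^ l).totient = p ^ n * (p ^ n).totient := by
  have hsum (m : ℕ) : ∑ l ∈ Finset.Icc 0 m, (p ^ l).totient = p ^ m := by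
    rw [← Nat.sum_totient (p ^ m), Nat.sum_divisors_prime_pow hp, Finset.range_eq_Ico]
    rfl
  have h1 (k : ℕ) (hk : k ∈ Finset.Icc 1 n) : ∑ l ∈ Finset.Icc 0 (n - k),
      (p ^ k).totient * (p ^ k).totient * (p ^ l).totient = (p ^ n).totient * (p ^ k).totient := by
    obtain ⟨hk1, hkn⟩ := Finset.mem_Icc.1 hk
    rw [← Finset.mul_sum, hsum, mul_assoc, mul_comm, mul_assoc, mul_comm (p ^ (n - k))]
    rw [mul_comm]
    congr 1
    rw [Nat.totient_prime_pow hp (by omega), Nat.totient_prime_pow hp (by omega), mul_right_comm,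
      ← pow_add]
    congr 2
    omega
  rw [Finset.sum_congr rfl h1, ← Finset.mul_sum, ← hsum n,
    ← Finset.add_sum_Ioc_eq_sum_Icc (Nat.zero_le n)]
  simp only [pow_zero, Nat.totient_one]
  have : Finset.Ioc 0 n = Finset.Icc 1 n := by ext; simp; omega
  rw [this]
  ring

/-! ### The simple components and the isomorphism -/

/-- The one-dimensional components: the generator of the automorphism group acts as `ζ_d`. -/
theorem exists_algHom_cyclotomicField {C : Type*} [Group C] [Finite C] {c : C} {α : MulAut C}
    {a : ℕ} (hc : ∀ x, x ∈ Subgroup.zpowers c) (hα : ∀ x, x ∈ Subgroup.zpowers α)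
    (hac : α c = c ^ a) {d : ℕ} (hd : 0 < d) (hdα : d ∣ orderOf α) :
    ∃ f : MonoidAlgebra ℚ (Hol C) →ₐ[ℚ] CyclotomicField d ℚ, Function.Surjective f ∧
      f (MonoidAlgebra.of ℚ (Hol C) (SemidirectProduct.inl c)) = 1 ∧
      aeval (f (MonoidAlgebra.of ℚ (Hol C) (SemidirectProduct.inr α))) (cyclotomic d ℚ) = 0 := by
  have : NeZero d := ⟨hd.ne'⟩
  have hζ := IsCyclotomicExtension.zeta_spec d ℚ (CyclotomicField d ℚ)
  obtain ⟨f, hf1, hf2⟩ := exists_algHom_monoidAlgebra_hol hc hα hac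
    (z := (1 : CyclotomicField d ℚ)) (T := IsCyclotomicExtension.zeta d ℚ (CyclotomicField d ℚ))
    (one_pow _) (hζ.pow_eq_one_iff_dvd _ |>.2 hdα) (by simp [SemiconjBy])
  refine ⟨f, fun y => ?_, hf1, ?_⟩
  · obtain ⟨P, rfl⟩ := CyclotomicField.exists_aeval_eq hd hζ y
    exact ⟨aeval (MonoidAlgebra.of ℚ (Hol C) (SemidirectProduct.inr α)) P, by
      rw [← aeval_algHom_apply, hf2]⟩
  · rw [hf2, hζ.aeval_cyclotomic_eq_zero hd]

/-- The matrix components of the group algebra of the holomorph. -/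
theorem exists_algHom_matrix {p n : ℕ} (hp : p.Prime) (hp2 : p ≠ 2) {C : Type*} [Group C]
    [Finite C] {c : C} {α : MulAut C} {a : ℕ} (hc : ∀ x, x ∈ Subgroup.zpowers c)
    (hoc : orderOf c = p ^ n) (hα : ∀ x, x ∈ Subgroup.zpowers α)
    (hoα : orderOf α = (p ^ n).totient) (hac : α c = c ^ a) {k l : ℕ} (hk : 1 ≤ k)
    (hkl : k + l ≤ n) (ha : orderOf (a : ZMod (p ^ k)) = (p ^ k).totient) :
    ∃ f : MonoidAlgebra ℚ (Hol C) →ₐ[ℚ] Matrix (Fin (p ^ k).totient) (Fin (p ^ k).totient)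
        (CyclotomicField (p ^ l) ℚ), Function.Surjective f ∧
      aeval (f (MonoidAlgebra.of ℚ (Hol C) (SemidirectProduct.inl c))) (cyclotomic (p ^ k) ℚ) = 0 ∧
      aeval (f (MonoidAlgebra.of ℚ (Hol C) (SemidirectProduct.inr α)) ^ (p ^ k).totient)
        (cyclotomic (p ^ l) ℚ) = 0 := by
  obtain ⟨ω, z, T, hω, hz, hzΦ, hTz, hTr, hgen⟩ := exists_matrix_generators hp hp2 l ha
  have hz1 : z ^ orderOf c = 1 := by
    rw [hoc, ← Nat.add_sub_cancel' (show k ≤ n by omega), pow_add, pow_mul, hz, one_pow]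
  have hT1 : T ^ orderOf α = 1 := by
    -- Thus `T ^ φ(p ^ n) = ω ^ p ^ (n - k)`, which is `1` exactly when `l ≤ n - k`: this bounds
    -- `l`.
    have h1 : (p ^ n).totient = (p ^ k).totient * p ^ (n - k) := by
      rw [Nat.totient_prime_pow hp (by omega), Nat.totient_prime_pow hp (by omega),
        mul_right_comm, ← pow_add]
      congr 2
      omega
    have h2 : ω ^ p ^ (n - k) = 1 :=
      (hω.pow_eq_one_iff_dvd _).2 (pow_dvd_pow p (by omega))
    rw [hoα, h1, pow_mul, hTr, ← map_pow, h2, map_one]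
  obtain ⟨f, hf1, hf2⟩ := exists_algHom_monoidAlgebra_hol hc hα hac hz1 hT1 hTz
  refine ⟨f, ?_, ?_, ?_⟩
  · rw [← AlgHom.range_eq_top]
    exact hgen _ ⟨_, hf1⟩ ⟨_, hf2⟩
  · rw [hf1, hzΦ]
  · rw [hf2, hTr]
    exact (aeval_algebraMap_apply _ ω _).trans
      (by rw [hω.aeval_cyclotomic_eq_zero (pow_pos hp.pos l), map_zero])

theorem CyclotomicField.finrank_rat {m : ℕ} (hm : 0 < m) :
    Module.finrank ℚ (CyclotomicField m ℚ) = m.totient := by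
  have : NeZero m := ⟨hm.ne'⟩
  exact IsCyclotomicExtension.finrank _ (cyclotomic.irreducible_rat hm)

theorem finrank_wedderburn_components {p n : ℕ} (hp : p.Prime) :
    Module.finrank ℚ ((∀ d : (Nat.totient (p ^ n)).divisors, CyclotomicField (d : ℕ) ℚ) ×
        (∀ (k : Finset.Icc 1 n) (l : Finset.Icc 0 (n - (k : ℕ))),
          Matrix (Fin (Nat.totient (p ^ (k : ℕ)))) (Fin (Nat.totient (p ^ (k : ℕ))))
            (CyclotomicField (p ^ (l : ℕ)) ℚ))) = p ^ n * (p ^ n).totient := by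
  rw [Module.finrank_prod, Module.finrank_pi_fintype, Module.finrank_pi_fintype,
    ← sum_totient_mul_totient_prime_pow hp n]
  congr 1
  · conv_rhs => rw [← Nat.sum_totient (p ^ n).totient]
    rw [← Finset.sum_coe_sort (p ^ n).totient.divisors]
    exact Finset.sum_congr rfl fun d _ =>
      CyclotomicField.finrank_rat (Nat.pos_of_mem_divisors d.2)
  · rw [← Finset.sum_coe_sort (Finset.Icc 1 n)]
    refine Finset.sum_congr rfl fun k _ => ?_
    rw [Module.finrank_pi_fintype, ← Finset.sum_coe_sort (Finset.Icc 0 (n - (k : ℕ)))]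
    refine Finset.sum_congr rfl fun l _ => ?_
    rw [Module.finrank_matrix, CyclotomicField.finrank_rat (pow_pos hp.pos _), Fintype.card_fin]

theorem finrank_monoidAlgebra_hol {p n : ℕ} {C : Type*} [Group C]
    (hC : Nat.card C = p ^ n) (hA : Nat.card (MulAut C) = (p ^ n).totient) :
    Module.finrank ℚ (MonoidAlgebra ℚ (Hol C)) = p ^ n * (p ^ n).totient := by
  rw [Module.finrank_eq_nat_card_basis (MonoidAlgebra.basis (Hol C) ℚ), SemidirectProduct.card,
    hC, hA]

theorem theorem8p0p1 (p n : ℕ) (hp : p.Prime) (hp2 : p ≠ 2) (hn : 1 ≤ n)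
    (C : Type*) [Group C] [IsCyclic C] (hC : Nat.card C = p ^ n) :
    Nonempty (MonoidAlgebra ℚ (Hol C) ≃ₐ[ℚ]
      ((∀ d : (Nat.totient (p ^ n)).divisors, CyclotomicField (d : ℕ) ℚ) ×
        (∀ (k : Finset.Icc 1 n) (l : Finset.Icc 0 (n - (k : ℕ))),
          Matrix (Fin (Nat.totient (p ^ (k : ℕ)))) (Fin (Nat.totient (p ^ (k : ℕ))))
            (CyclotomicField (p ^ (l : ℕ)) ℚ)))) := by
  have : Finite C := Nat.finite_of_card_ne_zero (hC ▸ (pow_pos hp.pos n).ne')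
  obtain ⟨c, α, a, hc, hoc, hα, hoα, hac, ha⟩ :=
    exists_generators_of_card_eq_prime_pow hp hp2 C hC
  choose f hfs hf1 hfΦ using fun d : (Nat.totient (p ^ n)).divisors =>
    exists_algHom_cyclotomicField hc hα hac (Nat.pos_of_mem_divisors d.2)
      ((Nat.dvd_of_mem_divisors d.2).trans hoα.symm.dvd)
  have hg (k : Finset.Icc 1 n) (l : Finset.Icc 0 (n - (k : ℕ))) := by
    have hk := Finset.mem_Icc.1 k.2
    have hl := Finset.mem_Icc.1 l.2
    exact exists_algHom_matrix (l := l) hp hp2 hc hoc hα hoα hac hk.1 (by omega) (ha k hk.2)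
  choose g hgs hgz hgT using hg
  set x := MonoidAlgebra.of ℚ (Hol C) (SemidirectProduct.inl c)
  set y := MonoidAlgebra.of ℚ (Hol C) (SemidirectProduct.inr α)
  have hinj : Function.Injective (p ^ · : ℕ → ℕ) := Nat.pow_right_injective hp.two_le
  let F₀ := AlgHom.pi f
  let G (k : Finset.Icc 1 n) := AlgHom.pi (g k)
  let F₁ := AlgHom.pi G
  have hF₀ : Function.Surjective F₀ := by
    refine pi_surjective_of_separating (fun d => f d) hfs fun d => ?_
    obtain ⟨e, he1, he0⟩ := exists_cyclotomic_idempotent (Nat.totient (p ^ n)).divisors d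
    refine ⟨aeval y e, ?_, fun d' hd' => ?_⟩
    · rw [← aeval_algHom_apply,
        aeval_eq_of_aeval_eq_zero_of_dvd_sub (hfΦ d) he1, map_one]
    · rw [← aeval_algHom_apply]
      exact aeval_eq_zero_of_dvd_aeval_eq_zero (he0 d' d'.2 (Subtype.coe_ne_coe.2 hd')) (hfΦ d')
  have hG (k) : Function.Surjective (G k) := by
    refine pi_surjective_of_separating (fun l => g k l) (hgs k) fun l => ?_
    obtain ⟨e, he1, he0⟩ :=
      exists_cyclotomic_idempotent ((Finset.Icc 0 (n - k)).image (p ^ ·)) (p ^ (l : ℕ))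
    -- For fixed `k`, this power of `y` is a root of the `p ^ l`-th cyclotomic polynomial in
    -- component `l`, so it separates the `l`.
    refine ⟨aeval (y ^ (p ^ (k : ℕ)).totient) e, ?_, fun l' hl' => ?_⟩
    · rw [← aeval_algHom_apply, map_pow,
        aeval_eq_of_aeval_eq_zero_of_dvd_sub (hgT k l) he1, map_one]
    · rw [← aeval_algHom_apply, map_pow]
      exact aeval_eq_zero_of_dvd_aeval_eq_zero (he0 _ (Finset.mem_image_of_mem _ l'.2)
        (hinj.ne (Subtype.coe_ne_coe.2 hl'))) (hgT k l')
  have hGz (k) : aeval (G k x) (cyclotomic (p ^ (k : ℕ)) ℚ) = 0 := by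
    rw [aeval_algHom_apply]
    refine funext fun l => ?_
    exact (aeval_algHom_apply (g k l) x _).symm.trans (hgz k l)
  have hF₁ : Function.Surjective F₁ := by
    refine pi_surjective_of_separating (fun k => G k) hG fun k => ?_
    obtain ⟨e, he1, he0⟩ :=
      exists_cyclotomic_idempotent ((Finset.Icc 1 n).image (p ^ ·)) (p ^ (k : ℕ))
    refine ⟨aeval x e, ?_, fun k' hk' => ?_⟩
    · rw [← aeval_algHom_apply,
        aeval_eq_of_aeval_eq_zero_of_dvd_sub (hGz k) he1, map_one]
    · rw [← aeval_algHom_apply]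
      exact aeval_eq_zero_of_dvd_aeval_eq_zero (he0 _ (Finset.mem_image_of_mem _ k'.2)
        (hinj.ne (Subtype.coe_ne_coe.2 hk'))) (hGz k')
  have hF : Function.Surjective (F₀.prod F₁) := by
    refine prod_surjective_of_separating F₀ F₁ hF₀ hF₁ ?_
    -- The fields form the level `k = 0`: there `x` maps to `1`, the root of the first cyclotomic
    -- polynomial.
    obtain ⟨e, he1, he0⟩ := exists_cyclotomic_idempotent ((Finset.Icc 1 n).image (p ^ ·)) 1
    have hF₀x : F₀ x = 1 := funext hf1
    refine ⟨aeval x e, ?_, ?_⟩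
    · rw [← aeval_algHom_apply, hF₀x,
        aeval_eq_of_aeval_eq_zero_of_dvd_sub (by simp) he1, map_one]
    · refine funext fun k => ?_
      refine (aeval_algHom_apply (G k) x e).symm.trans ?_
      refine aeval_eq_zero_of_dvd_aeval_eq_zero (he0 _ (Finset.mem_image_of_mem _ k.2) ?_) (hGz k)
      exact (Nat.one_lt_pow (by have := Finset.mem_Icc.1 k.2; omega) hp.one_lt).ne'
  have hdim := (finrank_monoidAlgebra_hol hC
    ((orderOf_eq_card_of_forall_mem_zpowers hα).symm.trans hoα)).trans
      (finrank_wedderburn_components (n := n) hp).symm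
  have : Finite (Hol C) := Finite.of_equiv _ SemidirectProduct.equivProd.symm
  have : Module.Finite ℚ (MonoidAlgebra ℚ (Hol C)) :=
    Module.Finite.of_basis (MonoidAlgebra.basis (Hol C) ℚ)
  refine ⟨AlgEquiv.ofBijective (F₀.prod F₁) ⟨?_, hF⟩⟩
  exact (LinearMap.injective_iff_surjective_of_finrank_eq_finrank
    (f := (F₀.prod F₁).toLinearMap) hdim).2 hF
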